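/- For a finite graph $G$, let $\gamma(G)$ denote its domination number, i.e. the smallest size of a set $K\subseteq V(G)$ such that every vertex $v\in V(G)\setminus K$ has at least one neighbour in $K$. Let $G_{n,p}$ denote the binomial random graph on $n$ vertices in which each pair of vertices is an edge independently with probability $p$. Let $p=p(n)\in[0,1]$ satisfy $n^{-1}\ll p\ll(\log n)^{2/3}n^{-2/3}$, where $a_n\ll b_n$ means $a_n=o(b_n)$ as $n\to\infty$. Then there exists $q=q(n)\in[0,1]$ with $p(n)\le q(n)\le 2p(n)$ for all $n$ such that, for infinitely many $n$, $$\max_{r\ge 0}\,\Pr\bigl(\gamma(G_{n,q(n)})\in\{r,r+1\}\bigr)\le \tfrac34,$$ where the maximum is over all integers $r\ge 0$. -/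

import Mathlib

/-- `K` is a dominating set of `G`: every vertex outside `K` has a neighbour in `K`. -/
def SimpleGraph.IsDominatingSet {V : Type*} (G : SimpleGraph V) (K : Finset V) : Prop :=
  ∀ v, v ∉ K → ∃ w ∈ K, G.Adj v w

/-- The domination number `γ(G)` of a finite graph: the smallest size of a dominating set. -/
noncomputable def SimpleGraph.dominationNumber {V : Type*} [Fintype V] (G : SimpleGraph V) : ℕ :=
  sInf {k : ℕ | ∃ K : Finset V, G.IsDominatingSet K ∧ K.card = k}

/-- The domination number is attained, so the infimum above is a minimum. -/
theorem SimpleGraph.exists_isDominatingSet_card_eq {V : Type*} [Fintype V] (G : SimpleGraph V) :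
    ∃ K : Finset V, G.IsDominatingSet K ∧ K.card = G.dominationNumber :=
  Nat.sInf_mem (s := {k : ℕ | ∃ K : Finset V, G.IsDominatingSet K ∧ K.card = k})
    ⟨_, Finset.univ, fun v hv => absurd (Finset.mem_univ v) hv, rfl⟩

open MeasureTheory Measure ProbabilityTheory unitInterval Filter Topology
open scoped Finset

/-! ### Comparison of binomial measures with nearby edge probabilities -/

namespace SimpleGraph

/-! Fix a large `n`, put `L = log (np)`, and suppose that every `q` in `[p, 2p]` gives some pair
`{r, r+1}` mass above 3/4. Changing the edge probability by `δ` with `2(nδ)² ≤ p` keeps the two laws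
close in chi-squared distance, so the pair can drop by at most 1
(`le_add_one_of_binomialRandom_real_gt`). About `2n√p` such steps lead from `p` to `2p`, so the
total drop is at most about `2n√p`.

The domination number itself drops much further. At `p` a first moment bound puts it above
`3L/(4p)`; at `2p` a set of about `L/(2p)` vertices together with the vertices it misses dominates,
which costs at most `L/(2p) + O(1/p)`. The gap of order `L/p` exceeds `2n√p` because `n p^(3/2)` is
small compared with `L`; this is where `p ≪ (log n / n)^(2/3)` enters. The conclusion in fact holds
for all large `n`. -/

theorem binomialRandom_real_singleton {V : Type*} [Finite V] (p : I) (G : SimpleGraph V) :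
    (binomialRandom V p).real {G} = (p : ℝ) ^ G.edgeSet.ncard *
      (1 - p : ℝ) ^ ((Nat.card V).choose 2 - G.edgeSet.ncard) := by
  simp [measureReal_def]

theorem ncard_edgeSet_le_choose_two {V : Type*} [Finite V] (G : SimpleGraph V) :
    G.edgeSet.ncard ≤ (Nat.card V).choose 2 := by
  classical
  have := Fintype.ofFinite V
  rw [Nat.card_eq_fintype_card, ← Set.coe_toFinset G.edgeSet, Set.ncard_coe_finset]
  exact G.card_edgeFinset_le_card_choose_two

instance {V : Type*} [Finite V] : MeasurableSingletonClass (SimpleGraph V) where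
  measurableSet_singleton G := by
    rw [← (measurableEmbedding_edgeSet).measurableSet_image]
    simp

/-- After division by `(a + b)^N`, where `N` is the number of vertex pairs, this is the total mass
of the binomial measure with parameter `a / (a + b)`. -/
theorem sum_pow_edgeSet_mul_pow {V : Type*} [Fintype V] [Fintype (SimpleGraph V)] {a b : ℝ}
    (ha : 0 ≤ a) (hb : 0 < b) :
    ∑ G : SimpleGraph V, a ^ G.edgeSet.ncard *
      b ^ ((Nat.card V).choose 2 - G.edgeSet.ncard) = (a + b) ^ (Nat.card V).choose 2 := by
  have hab : 0 < a + b := by positivity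
  let t : I := ⟨a / (a + b), by positivity, by rw [div_le_one hab]; linarith⟩
  have ht : 1 - (t : ℝ) = b / (a + b) := by
    change 1 - a / (a + b) = _
    field_simp
    ring
  have h := sum_measureReal_singleton (μ := binomialRandom V t) (Finset.univ)
  rw [Finset.coe_univ, probReal_univ] at h
  rw [← mul_one ((a + b) ^ _), ← h, Finset.mul_sum]
  refine Finset.sum_congr rfl fun G _ ↦ ?_
  rw [binomialRandom_real_singleton, ht]
  change _ = _ * ((a / (a + b)) ^ _ * _)
  have hle := G.ncard_edgeSet_le_choose_two
  rw [div_pow, div_pow, div_mul_div_comm, ← pow_add, Nat.add_sub_cancel' hle]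
  field_simp

/-- Cauchy–Schwarz on the point masses, with weights `w` satisfying `Q{G}² = P{G} w(G)`. The total
weight is the second moment of the likelihood ratio, which factors over vertex pairs. -/
theorem binomialRandom_real_sq_le {V : Type*} [Fintype V] {p q : I} (hp : 0 < (p : ℝ))
    (hp1 : (p : ℝ) < 1) (hq1 : (q : ℝ) < 1) (S : Set (SimpleGraph V)) :
    (binomialRandom V q).real S ^ 2 ≤ (binomialRandom V p).real S *
      (1 + (q - p : ℝ) ^ 2 / (p * (1 - p))) ^ (Nat.card V).choose 2 := by
  classical
  have hp' : 0 < 1 - (p : ℝ) := by linarith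
  have hq' : 0 < 1 - (q : ℝ) := by linarith
  have hq0 : 0 ≤ (q : ℝ) := q.2.1
  have e : 1 + (q - p : ℝ) ^ 2 / (p * (1 - p)) = (q : ℝ) ^ 2 / p + (1 - q : ℝ) ^ 2 / (1 - p) := by
    field_simp
    ring
  rw [e, ← sum_pow_edgeSet_mul_pow (by positivity) (by positivity),
    ← Set.coe_toFinset S, ← sum_measureReal_singleton, ← sum_measureReal_singleton]
  set w : SimpleGraph V → ℝ := fun G ↦ ((q : ℝ) ^ 2 / p) ^ G.edgeSet.ncard *
    ((1 - q : ℝ) ^ 2 / (1 - p)) ^ ((Nat.card V).choose 2 - G.edgeSet.ncard)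
  have hw : ∀ G, 0 ≤ w G := fun G ↦ by positivity
  refine (Finset.sum_sq_le_sum_mul_sum_of_sq_le_mul S.toFinset
    (f := fun G ↦ (binomialRandom V p).real {G}) (g := w)
    (fun _ _ ↦ measureReal_nonneg) (fun G _ ↦ hw G) fun G _ ↦ le_of_eq ?_).trans ?_
  · simp only [binomialRandom_real_singleton, w, div_pow, mul_pow]
    field_simp
    simp only [← pow_mul, mul_comm 2]
  · gcongr
    exact Finset.subset_univ _
-- Probabilities of domination events and first moment bounds
theorem infinitePi_bernoulli_real_exists {ι : Type*} [Fintype ι] (p : I) :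
    (infinitePi fun _ : ι ↦ toNNReal p • dirac True + toNNReal (σ p) • dirac False).real
      {ω | ∃ i, ω i} = 1 - (1 - p : ℝ) ^ Fintype.card ι := by
  have hc : {ω : ι → Prop | ∃ i, ω i} = {fun _ ↦ False}ᶜ := by
    ext ω
    simp [funext_iff]
  rw [hc, probReal_compl_eq_one_sub (measurableSet_singleton _), measureReal_def,
    infinitePi_singleton_of_fintype]
  simp

/-- The event depends only on the pairs between `Kᶜ` and `K`. These are distinct, so their
indicators are i.i.d. and can be curried into one independent row per outside vertex. -/
theorem binomialRandom_real_isDominatingSet {V : Type*} [Fintype V] (p : I) (K : Finset V) :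
    (binomialRandom V p).real {G | G.IsDominatingSet K} =
      (1 - (1 - p : ℝ) ^ #K) ^ (Fintype.card V - #K) := by
  classical
  let ν : Measure Prop := toNNReal p • dirac True + toNNReal (σ p) • dirac False
  let μ : Sym2 V → Measure Prop := fun e ↦
    toNNReal p • dirac (¬ e.IsDiag) + toNNReal (σ p) • dirac False
  let f : ↥Kᶜ × K → Sym2 V := fun a ↦ s(a.1.1, a.2.1)
  have hne (v : ↥Kᶜ) (w : K) : v.1 ≠ w.1 := fun h ↦ Finset.mem_compl.1 v.2 (h ▸ w.2)
  have hf : Function.Injective f := by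
    rintro ⟨v, w⟩ ⟨v', w'⟩ h
    have h' := h
    simp only [f, Sym2.eq_iff] at h'
    rcases h' with ⟨h1, h2⟩ | ⟨h1, h2⟩
    · exact Prod.ext (Subtype.ext h1) (Subtype.ext h2)
    · exact absurd h1 (hne v w')
  have hμf : (fun a ↦ μ (f a)) = fun _ ↦ ν := by
    ext1 ⟨v, w⟩
    simp [μ, ν, f, hne]
  have hμ (e : Sym2 V) : IsProbabilityMeasure (μ e) := ⟨by simp [μ]⟩
  have hν : IsProbabilityMeasure ν := ⟨by simp [ν]⟩
  have h1 := map_infinitePi_infinitePi_of_inj (P := μ) hf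
  have h2 := infinitePi_map_curry (fun (_ : ↥Kᶜ) (_ : K) ↦ ν)
  rw [hμf] at h1
  rw [← h1, Measure.map_map (by fun_prop) (by fun_prop)] at h2
  have hev : binomialRandom V p {G | G.IsDominatingSet K} =
      (infinitePi fun _ : ↥Kᶜ ↦ infinitePi fun _ : K ↦ ν)
        (Set.univ.pi fun _ ↦ {ω | ∃ i, ω i}) := by
    rw [← h2, Measure.map_apply (by fun_prop) .of_discrete, binomialRandom_eq_map,
      Measure.map_apply measurable_fromEdgeSet (Set.toFinite _).measurableSet, setBernoulli_apply']
    congr 1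
    ext ω
    simp only [IsDominatingSet, Set.mem_preimage, Set.mem_ofPred_eq, fromEdgeSet_adj,
      Set.mem_pi, Set.mem_univ, true_imp_iff, Function.comp_apply, f]
    constructor
    · rintro h v
      obtain ⟨w, hw, h⟩ := h v.1 (Finset.mem_compl.1 v.2)
      exact ⟨⟨w, hw⟩, h.1⟩
    · rintro h v hv
      obtain ⟨w, h⟩ := h ⟨v, Finset.mem_compl.2 hv⟩
      exact ⟨w.1, w.2, h, fun e ↦ hv (e ▸ w.2)⟩
  have h3 := infinitePi_bernoulli_real_exists (ι := K) p
  rw [measureReal_def] at h3 ⊢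
  rw [hev, infinitePi_pi_univ _ fun _ ↦ .of_discrete, tprod_fintype, Finset.prod_const,
    ENNReal.toReal_pow, h3]
  simp [Finset.card_compl]

theorem binomialRandom_real_forall_not_adj {V : Type*} [Fintype V] (p : I) (K : Finset V)
    {v : V} (hv : v ∉ K) :
    (binomialRandom V p).real {G | ∀ w ∈ K, ¬ G.Adj v w} = (1 - p : ℝ) ^ #K := by
  classical
  let μ : Sym2 V → Measure Prop := fun e ↦
    toNNReal p • dirac (¬ e.IsDiag) + toNNReal (σ p) • dirac False
  have hμ (e : Sym2 V) : IsProbabilityMeasure (μ e) := ⟨by simp [μ]⟩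
  have hne {w : V} (hw : w ∈ K) : v ≠ w := fun h ↦ hv (h ▸ hw)
  have hev : binomialRandom V p {G | ∀ w ∈ K, ¬ G.Adj v w} = infinitePi μ
      (Set.pi (K.image fun w ↦ s(v, w)) fun _ ↦ {False}) := by
    rw [binomialRandom_eq_map,
      Measure.map_apply measurable_fromEdgeSet (Set.toFinite _).measurableSet, setBernoulli_apply']
    congr 1
    ext ω
    simp only [Set.mem_preimage, Set.mem_ofPred_eq, fromEdgeSet_adj, Set.mem_pi]
    simp +contextual [hne]
  rw [measureReal_def, hev, infinitePi_pi _ fun _ _ ↦ measurableSet_singleton _,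
    Finset.prod_image fun _ _ _ _ h ↦ Sym2.congr_right.1 h,
    Finset.prod_congr rfl fun w hw ↦ show μ s(v, w) {False} = toNNReal (σ p) by
      simp [μ, hne hw]]
  simp

theorem IsDominatingSet.mono {V : Type*} {G : SimpleGraph V} {K L : Finset V}
    (hK : G.IsDominatingSet K) (h : K ⊆ L) : G.IsDominatingSet L := fun v hv ↦
  have ⟨w, hw, hvw⟩ := hK v fun hv' ↦ hv (h hv')
  ⟨w, h hw, hvw⟩

theorem IsDominatingSet.dominationNumber_le {V : Type*} [Fintype V] {G : SimpleGraph V}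
    {K : Finset V} (hK : G.IsDominatingSet K) : G.dominationNumber ≤ #K :=
  Nat.sInf_le ⟨K, hK, rfl⟩

theorem binomialRandom_real_dominationNumber_le {V : Type*} [Fintype V] (p : I) {k : ℕ}
    (hk : k ≤ Fintype.card V) :
    (binomialRandom V p).real {G | G.dominationNumber ≤ k} ≤
      (Fintype.card V).choose k * (1 - (1 - p : ℝ) ^ k) ^ (Fintype.card V - k) := by
  classical
  calc (binomialRandom V p).real {G | G.dominationNumber ≤ k}
    _ ≤ (binomialRandom V p).real
        (⋃ K ∈ Finset.powersetCard k (Finset.univ : Finset V), {G | G.IsDominatingSet K}) := by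
      refine measureReal_mono (fun G hG ↦ ?_) (measure_ne_top _ _)
      obtain ⟨K, hK, hcard⟩ := G.exists_isDominatingSet_card_eq
      obtain ⟨L, hKL, -, hL⟩ := Finset.exists_subsuperset_card_eq (Finset.subset_univ K)
        (hcard.trans_le hG) (by simpa using hk)
      simp only [Set.mem_iUnion]
      exact ⟨L, by simp [hL], hK.mono hKL⟩
    _ ≤ ∑ K ∈ Finset.powersetCard k (Finset.univ : Finset V),
        (binomialRandom V p).real {G | G.IsDominatingSet K} := measureReal_biUnion_finset_le _ _
    _ = ∑ K ∈ Finset.powersetCard k (Finset.univ : Finset V),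
        (1 - (1 - p : ℝ) ^ k) ^ (Fintype.card V - k) := by
      refine Finset.sum_congr rfl fun K hK ↦ ?_
      rw [binomialRandom_real_isDominatingSet, (Finset.mem_powersetCard.1 hK).2]
    _ = _ := by simp

/-- Adding to `K` the set `U G` of vertices it fails to dominate gives a dominating set; Markov's
inequality controls the size of `U G`. -/
theorem mul_binomialRandom_real_le_dominationNumber {V : Type*} [Fintype V] (p : I)
    (K : Finset V) (s : ℝ) :
    s * (binomialRandom V p).real {G | #K + s ≤ G.dominationNumber} ≤
      Fintype.card V * (1 - p : ℝ) ^ #K := by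
  classical
  have hp1 : 0 ≤ 1 - (p : ℝ) := by linarith [p.2.2]
  let U : SimpleGraph V → Finset V := fun G ↦ {v ∈ Kᶜ | ∀ w ∈ K, ¬ G.Adj v w}
  have hdom (G : SimpleGraph V) : G.dominationNumber ≤ #K + #(U G) := by
    refine IsDominatingSet.dominationNumber_le (K := K ∪ U G) (fun v hv ↦ ?_) |>.trans
      (Finset.card_union_le _ _)
    simp only [U, Finset.mem_union, Finset.mem_filter, Finset.mem_compl, not_or, not_and,
      not_forall, not_not] at hv
    obtain ⟨w, hw, h⟩ := hv.2 hv.1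
    exact ⟨w, Finset.mem_union_left _ hw, h⟩
  have hU (G : SimpleGraph V) : (#(U G) : ℝ) =
      ∑ v ∈ Kᶜ, Set.indicator {G : SimpleGraph V | ∀ w ∈ K, ¬ G.Adj v w} 1 G := by
    simp [U, Set.indicator_apply]
  have hs : 0 ≤ s ∨ s < 0 := le_or_gt 0 s
  rcases hs with hs | hs
  swap
  · exact (mul_nonpos_of_nonpos_of_nonneg hs.le measureReal_nonneg).trans (by positivity)
  calc s * (binomialRandom V p).real {G | #K + s ≤ G.dominationNumber}
    _ ≤ s * (binomialRandom V p).real {G | s ≤ #(U G)} := by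
      refine mul_le_mul_of_nonneg_left (measureReal_mono fun G hG ↦ ?_) hs
      rw [Set.mem_ofPred_eq] at hG ⊢
      have : (G.dominationNumber : ℝ) ≤ #K + #(U G) := by exact_mod_cast hdom G
      linarith
    _ ≤ ∫ G, (#(U G) : ℝ) ∂binomialRandom V p :=
      mul_meas_ge_le_integral_of_nonneg (.of_forall fun _ ↦ Nat.cast_nonneg _)
        (.of_finite) s
    _ = ∑ v ∈ Kᶜ, (1 - p : ℝ) ^ #K := by
      simp_rw [hU]
      rw [integral_finsetSum _ fun _ _ ↦ .of_finite]
      refine Finset.sum_congr rfl fun v hv ↦ ?_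
      rw [integral_indicator_one (Set.toFinite _).measurableSet,
        binomialRandom_real_forall_not_adj p K (Finset.mem_compl.1 hv)]
    _ ≤ _ := by
      rw [Finset.sum_const, nsmul_eq_mul]
      gcongr
      exact Finset.card_le_univ _

/-! ### Slow movement of the concentration pair -/

/-- If `r ≥ s + 2` the two pairs are disjoint, so the event likely under `q` has mass at most 1/4
under `p`. A second moment of at most 9/4 then caps its mass under `q` at `√(1/4 · 9/4) = 3/4`. -/
theorem le_add_one_of_binomialRandom_real_gt {V : Type*} [Fintype V] {p q : I}
    (hp : 0 < (p : ℝ)) (hp2 : (p : ℝ) ≤ 1 / 2) (hq : (q : ℝ) < 1)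
    (hpq : 2 * (Fintype.card V * (q - p : ℝ)) ^ 2 ≤ p) {f : SimpleGraph V → ℕ} {r s : ℕ}
    (hr : 3 / 4 < (binomialRandom V p).real {G | f G = r ∨ f G = r + 1})
    (hs : 3 / 4 < (binomialRandom V q).real {G | f G = s ∨ f G = s + 1}) : r ≤ s + 1 := by
  by_contra! hrs
  set A : Set (SimpleGraph V) := {G | f G = r ∨ f G = r + 1}
  set B : Set (SimpleGraph V) := {G | f G = s ∨ f G = s + 1}
  have hAB : (binomialRandom V p).real B ≤ 1 / 4 := by
    have h1 : (binomialRandom V p).real B ≤ (binomialRandom V p).real Aᶜ :=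
      measureReal_mono fun G hB hA ↦ by
        simp only [A, B, Set.mem_ofPred_eq] at hA hB
        omega
    rw [probReal_compl_eq_one_sub (Set.toFinite _).measurableSet] at h1
    linarith
  have hN : ((1 + (q - p : ℝ) ^ 2 / (p * (1 - p))) ^ (Nat.card V).choose 2 : ℝ) ≤ 9 / 4 := by
    have hp' : 0 < 1 - (p : ℝ) := by linarith
    have hc : (((Nat.card V).choose 2 : ℕ) : ℝ) ≤ (Fintype.card V : ℝ) ^ 2 / 2 := by
      rw [Nat.card_eq_fintype_card, Nat.cast_choose_two]
      nlinarith [(Nat.cast_nonneg (Fintype.card V) : (0 : ℝ) ≤ _)]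
    calc ((1 + (q - p : ℝ) ^ 2 / (p * (1 - p))) ^ (Nat.card V).choose 2 : ℝ)
      _ ≤ Real.exp ((q - p : ℝ) ^ 2 / (p * (1 - p))) ^ (Nat.card V).choose 2 := by
        gcongr
        linarith [Real.add_one_le_exp ((q - p : ℝ) ^ 2 / (p * (1 - p)))]
      _ = Real.exp ((Nat.card V).choose 2 * ((q - p : ℝ) ^ 2 / (p * (1 - p)))) := by
        rw [Real.exp_nat_mul]
      _ ≤ Real.exp (1 / 2) := by
        gcongr
        calc ((Nat.card V).choose 2 * ((q - p : ℝ) ^ 2 / (p * (1 - p))))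
          _ ≤ (Fintype.card V : ℝ) ^ 2 / 2 * ((q - p : ℝ) ^ 2 / (p * (1 / 2))) := by
            gcongr
            linarith
          _ ≤ 1 / 2 := by
            have e : (Fintype.card V : ℝ) ^ 2 / 2 * ((q - p : ℝ) ^ 2 / (p * (1 / 2))) =
              (2 * (Fintype.card V * (q - p : ℝ)) ^ 2) / p / 2 := by
              field_simp
            rw [e]
            gcongr
            rwa [div_le_one hp]
      _ ≤ 9 / 4 := by
        have h : Real.exp (1 / 2) * Real.exp (1 / 2) = Real.exp 1 := by
          rw [← Real.exp_add]
          norm_num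
        nlinarith [Real.exp_one_lt_d9, Real.exp_pos (1 / 2)]
  have h := binomialRandom_real_sq_le hp (by linarith) hq B
  have h2 : (binomialRandom V q).real B ^ 2 ≤ 1 / 4 * (9 / 4) := by
    refine h.trans ((mul_le_mul_of_nonneg_left hN measureReal_nonneg).trans ?_)
    gcongr
  nlinarith

theorem le_add_of_binomialRandom_real_gt {V : Type*} [Fintype V] {q : ℕ → I} {M : ℕ}
    (hq : ∀ i ≤ M, 0 < (q i : ℝ) ∧ (q i : ℝ) ≤ 1 / 2)
    (hpq : ∀ i < M, 2 * (Fintype.card V * (q (i + 1) - q i : ℝ)) ^ 2 ≤ q i)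
    {f : SimpleGraph V → ℕ} {r : ℕ → ℕ}
    (hr : ∀ i ≤ M, 3 / 4 < (binomialRandom V (q i)).real {G | f G = r i ∨ f G = r i + 1}) :
    r 0 ≤ r M + M := by
  suffices ∀ i ≤ M, r 0 ≤ r i + i from this M le_rfl
  intro i hi
  induction i with
  | zero => simp
  | succ i ih =>
    have h := le_add_one_of_binomialRandom_real_gt (hq i (by omega)).1 (hq i (by omega)).2
      (by linarith [(hq (i + 1) hi).2]) (hpq i (by omega)) (hr i (by omega)) (hr (i + 1) hi)
    have := ih (by omega)
    omega

end SimpleGraph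

/-! ### Elementary estimates -/

/-- A single term of the binomial expansion of `(1/x + 1)^n` is at most the whole sum. -/
theorem Nat.cast_choose_le_exp_mul_pow (n k : ℕ) {x : ℝ} (hx : 0 < x) :
    (n.choose k : ℝ) ≤ Real.exp (n / x) * x ^ k := by
  rcases lt_or_ge n k with h | h
  · rw [Nat.choose_eq_zero_of_lt h, Nat.cast_zero]
    positivity
  have h1 : x⁻¹ ^ k * n.choose k ≤ (x⁻¹ + 1) ^ n := by
    rw [add_pow]
    have := Finset.single_le_sum (s := Finset.range (n + 1))
      (f := fun m ↦ x⁻¹ ^ m * 1 ^ (n - m) * (n.choose m : ℝ)) (fun _ _ ↦ by positivity)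
      (Finset.mem_range.2 (Nat.lt_succ_of_le h))
    simpa using this
  have h2 : (x⁻¹ + 1) ^ n ≤ Real.exp (n / x) := by
    rw [div_eq_mul_inv, Real.exp_nat_mul]
    gcongr
    exact Real.add_one_le_exp _
  have h3 := h1.trans h2
  rw [inv_pow, inv_mul_le_iff₀ (by positivity)] at h3
  linarith

theorem Real.exp_neg_mul_le_one_sub_pow {p : ℝ} (hp : 0 ≤ p) (hp' : p ≤ 1 / 10) (k : ℕ) :
    Real.exp (-(10 / 9 * p * k)) ≤ (1 - p) ^ k := by
  have h : Real.exp (-(10 / 9 * p)) ≤ 1 - p := by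
    rw [Real.exp_neg, inv_le_comm₀ (Real.exp_pos _) (by linarith)]
    refine le_trans ?_ (Real.add_one_le_exp _)
    rw [inv_le_iff_one_le_mul₀ (by linarith)]
    nlinarith
  calc Real.exp (-(10 / 9 * p * k)) = Real.exp (-(10 / 9 * p)) ^ k := by
        rw [← Real.exp_nat_mul]; ring_nf
    _ ≤ _ := by gcongr

/-! ### Location of the domination number at `p` and at `2p` -/

namespace SimpleGraph

theorem binomialRandom_real_dominationNumber_le_floor {n : ℕ} {p : I} (hp : 0 < (p : ℝ))
    (hp' : (p : ℝ) ≤ 1 / 10) (hL : 0 ≤ Real.log (n * p)) (hLn : 2 * Real.log (n * p) ≤ n * p)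
    (hx : 2 + Real.log (n * p) ^ 2 ≤ (n * p : ℝ) ^ (1 / 6 : ℝ) / 2) :
    (binomialRandom (Fin n) p).real
      {G | G.dominationNumber ≤ ⌊3 / 4 * Real.log (n * p) / p⌋₊} ≤ 3 / 4 := by
  have hn : (0 : ℝ) < n := by
    rcases Nat.eq_zero_or_pos n with rfl | h
    · norm_num at hx
    · exact_mod_cast h
  set L := Real.log (n * p) with hLdef
  set k := ⌊3 / 4 * L / p⌋₊
  have hx0 : (0 : ℝ) < n * p := by positivity
  have hxL : Real.exp L = n * p := Real.exp_log hx0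
  have hkL : k * (p : ℝ) ≤ 3 / 4 * L := by
    rw [← le_div_iff₀ hp]
    exact Nat.floor_le (by positivity)
  have hkn : (k : ℝ) ≤ n / 2 := by
    rw [← mul_le_mul_iff_left₀ hp]
    linarith
  have hkn' : k ≤ n := by
    have : (k : ℝ) ≤ n := by linarith
    exact_mod_cast this
  have h := binomialRandom_real_dominationNumber_le p (V := Fin n) (k := k) (by simpa using hkn')
  rw [Fintype.card_fin] at h
  refine h.trans ?_
  have hp1 : 0 ≤ 1 - (p : ℝ) := by linarith
  have hchoose : (n.choose k : ℝ) ≤ Real.exp ((1 + L ^ 2) / p) := by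
    refine (Nat.cast_choose_le_exp_mul_pow n k hx0).trans ?_
    rw [← hxL, ← Real.exp_nat_mul, ← Real.exp_add, hxL]
    gcongr
    rw [le_div_iff₀ hp, add_mul]
    have : n / (n * (p : ℝ)) * p = 1 := by field_simp
    rw [this]
    nlinarith
  -- The exponent is `10/9 · 3/4 = 5/6 < 1`. The surplus `(np)^(1/6)` beats the `1 + L²` coming from
  -- the choice of the set.
  have hpow : (n * p : ℝ) ^ (1 / 6 : ℝ) / 2 / p ≤ (n - k : ℕ) * (1 - p : ℝ) ^ k := by
    have h1 : (n * p : ℝ) ^ (-(5 / 6) : ℝ) ≤ (1 - p : ℝ) ^ k := by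
      refine le_trans ?_ (Real.exp_neg_mul_le_one_sub_pow hp.le hp' k)
      rw [Real.rpow_def_of_pos hx0, ← hLdef]
      gcongr
      linarith
    have h2 : (n / 2 : ℝ) ≤ (n - k : ℕ) := by
      rw [Nat.cast_sub hkn']
      linarith
    have h3 : (n * p : ℝ) ^ (1 / 6 : ℝ) = n * p * (n * p : ℝ) ^ (-(5 / 6) : ℝ) := by
      rw [← Real.rpow_one_add' hx0.le (by norm_num)]
      norm_num
    calc (n * p : ℝ) ^ (1 / 6 : ℝ) / 2 / p = n / 2 * (n * p : ℝ) ^ (-(5 / 6) : ℝ) := by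
          rw [h3]; field_simp
      _ ≤ _ := by gcongr
  calc (n.choose k : ℝ) * (1 - (1 - p : ℝ) ^ k) ^ (n - k)
    _ ≤ Real.exp ((1 + L ^ 2) / p) * Real.exp (-(1 - p : ℝ) ^ k) ^ (n - k) := by
      have h1 : 0 ≤ 1 - (1 - p : ℝ) ^ k := by
        linarith [pow_le_one₀ (n := k) hp1 (by linarith)]
      gcongr
      linarith [Real.add_one_le_exp (-(1 - p : ℝ) ^ k)]
    _ = Real.exp ((1 + L ^ 2) / p - (n - k : ℕ) * (1 - p : ℝ) ^ k) := by
      rw [← Real.exp_nat_mul, ← Real.exp_add]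
      ring_nf
    _ ≤ Real.exp (-1) := by
      gcongr
      have h4 : (2 + L ^ 2) / p ≤ (n * p : ℝ) ^ (1 / 6 : ℝ) / 2 / p := by gcongr
      have h5 : (2 + L ^ 2) / (p : ℝ) = (1 + L ^ 2) / p + 1 / p := by ring
      have h6 : 1 ≤ 1 / (p : ℝ) := by
        rw [one_le_div hp]
        linarith
      linarith
    _ ≤ 3 / 4 := by
      rw [Real.exp_neg, inv_le_comm₀ (Real.exp_pos _) (by norm_num)]
      linarith [Real.exp_one_gt_d9]

theorem binomialRandom_real_le_dominationNumber {n : ℕ} {p q : I} (hp : 0 < (p : ℝ))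
    (hq : (q : ℝ) = 2 * p) (hn : 2 ≤ n) :
    (binomialRandom (Fin n) q).real
      {G | ⌈Real.log (n * p) / (2 * p)⌉₊ + 2 / (p : ℝ) ≤ G.dominationNumber} ≤ 1 / 2 := by
  have hn' : (2 : ℝ) ≤ n := by exact_mod_cast hn
  have hx0 : (0 : ℝ) < n * p := by positivity
  set L := Real.log (n * p) with hLdef
  -- At edge probability `2p` this size leaves at most `n e^(-L) = 1/p` undominated vertices on
  -- average.
  set k := ⌈L / (2 * p)⌉₊
  have hL' : L / (2 * p) ≤ n / 2 := by
    rw [div_le_iff₀ (by positivity)]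
    linarith [Real.log_le_sub_one_of_pos hx0]
  have hk : k ≤ n := Nat.ceil_le.2 (by linarith)
  obtain ⟨K, -, hK⟩ := Finset.exists_subset_card_eq (s := (Finset.univ : Finset (Fin n)))
    (n := k) (by simpa using hk)
  have h := mul_binomialRandom_real_le_dominationNumber q K (2 / p)
  rw [hK, Fintype.card_fin] at h
  have hpow : (n : ℝ) * (1 - q : ℝ) ^ k ≤ 1 / p := by
    have h1 : L ≤ 2 * p * k := by
      rw [← div_le_iff₀' (by positivity)]
      exact Nat.le_ceil _
    calc (n : ℝ) * (1 - q : ℝ) ^ k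
      _ ≤ n * Real.exp (-(2 * p)) ^ k := by
        gcongr
        · linarith [q.2.2]
        · linarith [Real.add_one_le_exp (-(2 * p : ℝ))]
      _ ≤ n * Real.exp (-L) := by
        rw [← Real.exp_nat_mul]
        gcongr
        linarith
      _ = 1 / p := by
        rw [Real.exp_neg, Real.exp_log hx0]
        field_simp
  have h2 := h.trans hpow
  rw [div_mul_eq_mul_div, div_le_div_iff_of_pos_right hp] at h2
  linarith

/-! ### The contradiction along a chain from `p` to `2p` -/

theorem exists_binomialRandom_real_dominationNumber_le {n : ℕ} {p : I} (hp : 0 < (p : ℝ))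
    (hp' : (p : ℝ) ≤ 1 / 10) (hL : 40 ≤ Real.log (n * p))
    (hLn : 2 * Real.log (n * p) ≤ n * p)
    (hx : 2 + Real.log (n * p) ^ 2 ≤ (n * p : ℝ) ^ (1 / 6 : ℝ) / 2)
    (hpn : 16 * (n * ((p : ℝ) * √(p : ℝ))) < Real.log (n * p)) :
    ∃ q : I, (p : ℝ) ≤ q ∧ (q : ℝ) ≤ 2 * p ∧ ∀ r : ℕ, (binomialRandom (Fin n) q).real
      {G | G.dominationNumber = r ∨ G.dominationNumber = r + 1} ≤ 3 / 4 := by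
  by_contra! hcon
  have hn2 : 2 ≤ n := by
    by_contra! h
    have : (n : ℝ) ≤ 1 := by exact_mod_cast Nat.le_of_lt_succ h
    nlinarith
  have hn : (0 : ℝ) < n := by positivity
  -- With steps of size `p/M`, `n` times a step is at most `√p/2`, as the one-step comparison
  -- requires.
  set M := ⌈2 * n * √p⌉₊ with hM
  have hs : 0 < √(p : ℝ) := Real.sqrt_pos.2 hp
  have hM1 : 2 * n * √(p : ℝ) ≤ M := Nat.le_ceil _
  have hM0 : (0 : ℝ) < M := lt_of_lt_of_le (by positivity) hM1
  have hM2 : (M : ℝ) < 2 * n * √(p : ℝ) + 1 := Nat.ceil_lt_add_one (by positivity)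
  have hq (i : ℕ) (hi : i ≤ M) : p * (1 + i / M : ℝ) ≤ 2 * p := by
    have : (i / M : ℝ) ≤ 1 := by
      rw [div_le_one hM0]
      exact_mod_cast hi
    nlinarith
  have hqp (i : ℕ) : p ≤ p * (1 + i / M : ℝ) := by
    have : 0 ≤ (i / M : ℝ) := by positivity
    nlinarith
  let q : ℕ → I := fun i ↦ Set.projIcc 0 1 zero_le_one (p * (1 + i / M : ℝ))
  have hqc (i : ℕ) (hi : i ≤ M) : (q i : ℝ) = p * (1 + i / M : ℝ) := by
    simp only [q]
    rw [Set.projIcc_of_mem zero_le_one ⟨by linarith [hqp i], by linarith [hq i hi]⟩]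
  have hrex : ∀ i, ∃ r, i ≤ M → 3 / 4 < (binomialRandom (Fin n) (q i)).real
      {G | G.dominationNumber = r ∨ G.dominationNumber = r + 1} := by
    intro i
    by_cases hi : i ≤ M
    · obtain ⟨r, hr⟩ := hcon (q i) (by rw [hqc i hi]; exact hqp i) (by rw [hqc i hi]; exact hq i hi)
      exact ⟨r, fun _ ↦ hr⟩
    · exact ⟨0, fun h ↦ absurd h hi⟩
  choose r hr using hrex
  have hchain : r 0 ≤ r M + M := by
    refine le_add_of_binomialRandom_real_gt (q := q) (fun i hi ↦ ?_) (fun i hi ↦ ?_) hr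
    · rw [hqc i hi]
      exact ⟨by linarith [hqp i], by linarith [hq i hi]⟩
    · rw [hqc i hi.le, hqc (i + 1) hi, Fintype.card_fin]
      refine le_trans ?_ (hqp i)
      have e : (n : ℝ) * (p * (1 + (i + 1 : ℕ) / M) - p * (1 + i / M)) = n * p / M := by
        push_cast
        field_simp
        ring
      have h1 : (n * p / M : ℝ) ≤ √(p : ℝ) / 2 := by
        rw [div_le_iff₀ hM0]
        nlinarith [Real.mul_self_sqrt hp.le]
      have h2 : (0 : ℝ) ≤ n * p / M := by positivity
      rw [e]
      nlinarith [Real.mul_self_sqrt hp.le]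
  have hq0 : q 0 = p := Subtype.ext (by rw [hqc 0 (Nat.zero_le _)]; simp)
  have hqM : (q M : ℝ) = 2 * p := by
    rw [hqc M le_rfl, div_self hM0.ne']
    ring
  set L := Real.log (n * p) with hLdef
  have hlow : ⌊3 / 4 * L / p⌋₊ ≤ r 0 := by
    by_contra! h
    refine (binomialRandom_real_dominationNumber_le_floor hp hp' (by linarith) hLn hx).not_gt
      ((hr 0 (Nat.zero_le _)).trans_le ?_)
    rw [hq0]
    exact measureReal_mono fun G hG ↦ by
      rw [Set.mem_ofPred_eq] at hG ⊢
      have : G.dominationNumber ≤ ⌊3 / 4 * L / p⌋₊ := by omega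
      exact this
  have hupp : (r M : ℝ) < ⌈L / (2 * p)⌉₊ + 2 / p := by
    by_contra! h
    have h1 := binomialRandom_real_le_dominationNumber hp hqM hn2
    have h2 := (hr M le_rfl).trans_le (measureReal_mono
      (s₂ := {G : SimpleGraph (Fin n) | ⌈L / (2 * p)⌉₊ + 2 / (p : ℝ) ≤ G.dominationNumber}) fun G hG ↦ by
        rw [Set.mem_ofPred_eq] at hG ⊢
        have : r M ≤ G.dominationNumber := by omega
        have : (r M : ℝ) ≤ G.dominationNumber := by exact_mod_cast this
        linarith)
    linarith
  have h1 : 3 / 4 * L / p < r 0 + 1 := (Nat.lt_floor_add_one _).trans_le (by gcongr)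
  have h2 : (⌈L / (2 * p)⌉₊ : ℝ) < L / (2 * p) + 1 := Nat.ceil_lt_add_one (by positivity)
  have h3 : (r 0 : ℝ) ≤ r M + M := by exact_mod_cast hchain
  have h4 : 3 / 4 * L / p < L / (2 * p) + 2 / p + 2 * n * √(p : ℝ) + 3 := by linarith
  have h5 : 3 / 4 * L < L / 2 + 2 + 2 * n * √(p : ℝ) * p + 3 * p := by
    have := mul_lt_mul_of_pos_right h4 hp
    have e1 : 3 / 4 * L / p * (p : ℝ) = 3 / 4 * L := by field_simp
    have e2 : (L / (2 * p) + 2 / p + 2 * n * √(p : ℝ) + 3) * (p : ℝ) =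
      L / 2 + 2 + 2 * n * √(p : ℝ) * p + 3 * p := by field_simp
    linarith
  -- By `hpn` the term `2n√p·p` is below `L/8`, leaving `L/8 < 2 + 3p`, which is impossible for `L ≥
  -- 40` and `p ≤ 1/10`.
  linarith

end SimpleGraph

/-! ### Asymptotics and conclusion -/

theorem eventually_atTop_log_bounds : ∀ᶠ x : ℝ in atTop, 40 ≤ Real.log x ∧
    2 * Real.log x ≤ x ∧ 2 + Real.log x ^ 2 ≤ x ^ (1 / 6 : ℝ) / 2 := by
  have h1 := Real.isLittleO_log_id_atTop.bound (by norm_num : (0 : ℝ) < 1 / 2)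
  have h2 := (isLittleO_log_rpow_rpow_atTop (2 : ℝ) (by norm_num : (0 : ℝ) < 1 / 6)).bound
    (by norm_num : (0 : ℝ) < 1 / 4)
  have h3 := Real.tendsto_log_atTop.eventually_ge_atTop 40
  have h4 := (tendsto_rpow_atTop (by norm_num : (0 : ℝ) < 1 / 6)).eventually_ge_atTop 8
  filter_upwards [h1, h2, h3, h4, eventually_gt_atTop 0] with x h1 h2 h3 h4 h5
  have hx := Real.rpow_pos_of_pos h5 (1 / 6)
  rw [Real.rpow_two, Real.norm_of_nonneg (sq_nonneg _), Real.norm_of_nonneg hx.le] at h2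
  rw [id, Real.norm_of_nonneg (by linarith), Real.norm_of_nonneg h5.le] at h1
  exact ⟨h3, by linarith, by linarith⟩

theorem sixteen_mul_lt_log {n p : ℝ} (hn : 1 ≤ n) (hp : 0 < p) (hL : 40 ≤ Real.log (n * p))
    (hup : p ≤ 1 / 100 * (Real.log n ^ (2 / 3 : ℝ) * n ^ (-(2 / 3) : ℝ))) :
    16 * (n * (p * √p)) < Real.log (n * p) := by
  have hn0 : 0 < n := by linarith
  have hlog : 0 ≤ Real.log n := Real.log_nonneg hn
  have hps : p * √p = p ^ (3 / 2 : ℝ) := by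
    rw [Real.sqrt_eq_rpow, ← Real.rpow_one_add' hp.le (by norm_num)]
    norm_num
  rw [hps]
  -- For larger `p`, `log (np)` is comparable to `log n` and `hup` applies; for smaller `p`, `n
  -- p^(3/2) ≤ 1` and `hL` suffices.
  rcases le_or_gt (n ^ (-(3 / 4) : ℝ)) p with h | h
  · have h1 : Real.log n / 4 ≤ Real.log (n * p) := by
      have := Real.log_le_log (by positivity) h
      rw [Real.log_rpow hn0] at this
      rw [Real.log_mul hn0.ne' hp.ne']
      linarith
    have h2 : p ^ (3 / 2 : ℝ) ≤ 1 / 1000 * (Real.log n / n) := by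
      calc p ^ (3 / 2 : ℝ)
        _ ≤ (1 / 100 * (Real.log n ^ (2 / 3 : ℝ) * n ^ (-(2 / 3) : ℝ))) ^ (3 / 2 : ℝ) := by gcongr
        _ = (1 / 100 : ℝ) ^ (3 / 2 : ℝ) * (Real.log n * n⁻¹) := by
          rw [Real.mul_rpow (by norm_num) (by positivity), Real.mul_rpow (by positivity)
            (by positivity), ← Real.rpow_mul hlog, ← Real.rpow_mul hn0.le]
          norm_num [Real.rpow_neg_one]
        _ = 1 / 1000 * (Real.log n / n) := by
          rw [show (1 / 100 : ℝ) = (1 / 10) ^ (2 : ℝ) by norm_num, ← Real.rpow_mul (by norm_num),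
            div_eq_mul_inv (Real.log n)]
          norm_num
    have h3 : n * p ^ (3 / 2 : ℝ) ≤ Real.log n / 1000 := by
      calc n * p ^ (3 / 2 : ℝ) ≤ n * (1 / 1000 * (Real.log n / n)) := by gcongr
        _ = _ := by field_simp
    linarith
  · have h1 : n * p ^ (3 / 2 : ℝ) ≤ 1 := by
      calc n * p ^ (3 / 2 : ℝ) ≤ n * (n ^ (-(3 / 4) : ℝ)) ^ (3 / 2 : ℝ) := by gcongr
        _ = n ^ (-(1 / 8) : ℝ) := by
          rw [← Real.rpow_mul hn0.le, ← Real.rpow_one_add' hn0.le (by norm_num)]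
          norm_num
        _ ≤ 1 := Real.rpow_le_one_of_one_le_of_nonpos hn (by norm_num)
    linarith

theorem mainTheorem5 (p : ℕ → unitInterval)
    (hlow : (fun n : ℕ => (n : ℝ)⁻¹) =o[Filter.atTop] (fun n : ℕ => (p n : ℝ)))
    (hhigh : (fun n : ℕ => (p n : ℝ)) =o[Filter.atTop]
      (fun n : ℕ => Real.log (n : ℝ) ^ (2 / 3 : ℝ) * (n : ℝ) ^ (-(2 / 3) : ℝ))) :
    ∃ q : ℕ → unitInterval,
      (∀ n : ℕ, (p n : ℝ) ≤ (q n : ℝ) ∧ (q n : ℝ) ≤ 2 * (p n : ℝ)) ∧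
      ∃ᶠ n : ℕ in Filter.atTop, ∀ r : ℕ,
        (SimpleGraph.binomialRandom (Fin n) (q n)).real
          {G : SimpleGraph (Fin n) |
            G.dominationNumber = r ∨ G.dominationNumber = r + 1} ≤ 3 / 4 := by
  have hnp : Tendsto (fun n : ℕ ↦ (n : ℝ) * p n) atTop atTop := by
    refine tendsto_atTop.2 fun b ↦ ?_
    filter_upwards [hlow.bound (show (0 : ℝ) < (|b| + 1)⁻¹ by positivity),
      eventually_gt_atTop 0] with n hn hn0
    have hn0' : (0 : ℝ) < n := by exact_mod_cast hn0
    rw [norm_inv, Real.norm_of_nonneg hn0'.le, Real.norm_of_nonneg (p n).2.1,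
      inv_mul_eq_div, le_div_iff₀ (by positivity), inv_mul_le_iff₀ hn0'] at hn
    linarith [le_abs_self b]
  have hup : ∀ᶠ n : ℕ in atTop, (p n : ℝ) ≤
      1 / 100 * (Real.log n ^ (2 / 3 : ℝ) * (n : ℝ) ^ (-(2 / 3) : ℝ)) := by
    filter_upwards [hhigh.bound (show (0 : ℝ) < 1 / 100 by norm_num),
      eventually_ge_atTop 1] with n hn hn1
    have hlog := Real.log_nonneg (show (1 : ℝ) ≤ n by exact_mod_cast hn1)
    rwa [Real.norm_of_nonneg (p n).2.1, Real.norm_of_nonneg (by positivity)] at hn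
  have hev : ∀ᶠ n : ℕ in atTop, ∃ q : I, (p n : ℝ) ≤ q ∧ (q : ℝ) ≤ 2 * p n ∧
      ∀ r : ℕ, (SimpleGraph.binomialRandom (Fin n) q).real
        {G | G.dominationNumber = r ∨ G.dominationNumber = r + 1} ≤ 3 / 4 := by
    filter_upwards [hnp.eventually eventually_atTop_log_bounds, hup, hnp.eventually_gt_atTop 0,
      eventually_ge_atTop 1] with n ⟨h1, h2, h3⟩ h4 h5 hn
    have hn1 : (1 : ℝ) ≤ n := by exact_mod_cast hn
    have hp : 0 < (p n : ℝ) := pos_of_mul_pos_right h5 (by positivity)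
    refine SimpleGraph.exists_binomialRandom_real_dominationNumber_le hp (h4.trans ?_) h1 h2 h3
      (sixteen_mul_lt_log hn1 hp h1 h4)
    have h6 : Real.log n ^ (2 / 3 : ℝ) * (n : ℝ) ^ (-(2 / 3) : ℝ) ≤ 1 := by
      rw [Real.rpow_neg (by positivity), ← div_eq_mul_inv, div_le_one (by positivity)]
      have := Real.log_le_sub_one_of_pos (show (0 : ℝ) < n by linarith)
      have := Real.log_nonneg hn1
      gcongr
      linarith
    linarith
  -- The bounds on `q n` are needed for every `n`, so `p n` serves as the default where no good `q`
  -- exists.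
  choose q hq1 hq2 hq3 using fun n ↦ show ∃ q : I, (p n : ℝ) ≤ q ∧ (q : ℝ) ≤ 2 * p n ∧
      ((∃ q : I, (p n : ℝ) ≤ q ∧ (q : ℝ) ≤ 2 * p n ∧
        ∀ r : ℕ, (SimpleGraph.binomialRandom (Fin n) q).real
          {G | G.dominationNumber = r ∨ G.dominationNumber = r + 1} ≤ 3 / 4) →
        ∀ r : ℕ, (SimpleGraph.binomialRandom (Fin n) q).real
          {G | G.dominationNumber = r ∨ G.dominationNumber = r + 1} ≤ 3 / 4) by
    by_cases h : ∃ q : I, (p n : ℝ) ≤ q ∧ (q : ℝ) ≤ 2 * p n ∧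
        ∀ r : ℕ, (SimpleGraph.binomialRandom (Fin n) q).real
          {G | G.dominationNumber = r ∨ G.dominationNumber = r + 1} ≤ 3 / 4
    · obtain ⟨q, h1, h2, h3⟩ := h
      exact ⟨q, h1, h2, fun _ ↦ h3⟩
    · exact ⟨p n, le_rfl, by linarith [(p n).2.1], fun h' ↦ absurd h' h⟩
  exact ⟨q, fun n ↦ ⟨hq1 n, hq2 n⟩, (hev.mono hq3).frequently⟩
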